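/- Let $D=(z_1,\dots,z_n)$ be a fixed dataset with $z_i=(x_i,w_i)$, where $x_i$ are covariates and $w_i$ collects the remaining components (outcome, exposure, etc.). Let $\rho\in(0,1)$ and $m=\lfloor\rho n\rfloor\ge 1$. Let $(s,B)$ be a random seed-and-bag pair with law $\mathcal P$: the seed $s$ is uniform on a finite non-empty set of seeds and, independently, the bag $B$ is uniform on the $m$-element subsets of $\{1,\dots,n\}$. Let $\mathfrak F_1,\dots,\mathfrak F_p$ be regression algorithms; $\mathfrak F_l(D(B),s)(x)\in\mathbb R$ is the prediction at $x$ of the $l$th algorithm trained with seed $s$ on the sub-dataset $D(B)$ of the observations indexed by $B$. For a set $\zeta=\{(s_1,B^1),\dots,(s_V,B^V)\}$ of $V$ pairs put $M_{iv}=\mathbf 1[i\notin B^v]$, $C_i=\sum_{v=1}^V M_{iv}$, and define the cross-bagged predictions $$\bar\eta_{\zeta,l,i}=\frac1{C_i}\sum_{v=1}^V M_{iv}\,\mathfrak F_l(D(B^v),s_v)(x_i)$$ (with an arbitrary convention, say $0$, if $C_i=0$) and their idealized version $\bar\eta^\infty_{l,i}=E_{(s,B)}\left[\mathfrak F_l(D(B),s)(x_i)\mid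 i\notin B\right]$. Let $\Psi(D,\cdot):\mathbb R^{p\times n}\to\mathbb R$ be differentiable on an open set containing $\bar\eta^\infty$ (for instance on all of $\mathbb R^{p\times n}$). Let $\zeta$ and $\zeta'$ consist of the first $V$ members of two sequences of seed-and-bag pairs, all of them mutually independent with law $\mathcal P$. Then there is a number $\tau^2\ge0$, the asymptotic variance of $V^{1/2}(\Psi(D,\bar\eta_\zeta)-\Psi(D,\bar\eta^\infty))$, that is, as $V\to\infty$, $$V^{1/2}\left(\Psi(D,\bar\eta_\zeta)-\Psi(D,\bar\eta^\infty)\right)\rightsquigarrow\mathcal N(0,\tau^2),$$ such that $$V^{1/2}\left(\Psi(D,\bar\eta_\zeta)-\Psi(D,\bar\eta_{\zeta'})\right)\rightsquigarrow\mathcal N(0,2\tau^2)\qquad(V\to\infty).$$ If moreover the gradient of $\Psi(D,\cdot)$ is continuous at $\bar\eta^\infty$, then $$\hat\tau^2=\frac1{V(1-m/n)^2}\sum_{v=1}^V\left(\sum_{l=1}^p\sum_{i=1}^n\frac{\partial\Psi(D,\bar\eta_\zeta)}{\partial\bar\eta_{\zeta,l,i}}\,M_{iv}\left(\mathfrak F_l(D(B^v),s_v)(x_i)-\bar\eta_{\zeta,l,i}\right)\right)^2$$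 converges to $\tau^2$ in probability as $V\to\infty$. Here $\mathcal N(0,0)$ is the point mass at $0$. -/

import Mathlib

open MeasureTheory ProbabilityTheory Filter Topology
open scoped NNReal

noncomputable section

namespace CrossBagging

/-- Subsample size `m = ⌊ρ n⌋`. -/
def bagSize (ρ : ℝ) (n : ℕ) : ℕ := ⌊ρ * n⌋₊

/-- The bags: index subsamples of `[n]` of size `m`, drawn without replacement. -/
abbrev Bag (n m : ℕ) : Type := {B : Finset (Fin n) // B.card = m}

/-- Seed-and-bag pairs `(s, B)`, with `S` possible seeds. -/
abbrev SeedBag (S n m : ℕ) : Type := Fin S × Bag n m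

/-- The product of the uniform law on the seeds and the uniform law on the bags. -/
def seedBagLaw (S n m : ℕ) : Measure (SeedBag S n m) :=
  (uniformOn (Set.univ : Set (Fin S))).prod (uniformOn (Set.univ : Set (Bag n m)))

variable {𝒳 𝒲 : Type*} {S n m p : ℕ}

/-- A (randomised) regression algorithm: from a finite dataset of observations `(x, w)`, with `x`
the covariates and `w` the remaining components (outcome, exposure, …), and a seed, it produces a
prediction function of `x`. A dataset is a list, so the algorithm may depend on the order. -/
abbrev RegressionAlgorithm (𝒳 𝒲 : Type*) (S : ℕ) : Type _ := List (𝒳 × 𝒲) → Fin S → 𝒳 → ℝ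

/-- The sub-dataset `D(B)` of the observations indexed by `B`, in increasing order of index. -/
def subDataset (D : Fin n → 𝒳 × 𝒲) (B : Finset (Fin n)) : List (𝒳 × 𝒲) :=
  (B.sort (· ≤ ·)).map D

/-- `F_l(D(B), s)(x_i)`: the prediction for observation `i` by the `l`-th algorithm, trained on the
bag `B` with seed `s`. -/
def bagPrediction (F : Fin p → RegressionAlgorithm 𝒳 𝒲 S) (D : Fin n → 𝒳 × 𝒲)
    (l : Fin p) (i : Fin n) (c : SeedBag S n m) : ℝ :=
  F l (subDataset D c.2.1) c.1 (D i).1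

/-- The out-of-bag indicator `1[i ∉ B]`. -/
def outOfBag (i : Fin n) (c : SeedBag S n m) : ℝ :=
  if i ∈ c.2.1 then 0 else 1

/-- Cross-bagged nuisance predictions: for the `l`-th algorithm and observation `i`, the average of
the predictions for `i` over those among the `V` pairs `ζ` whose bag does not contain `i`. (If
there is none, the value is `0` by convention.) -/
def crossBagged (F : Fin p → RegressionAlgorithm 𝒳 𝒲 S) (D : Fin n → 𝒳 × 𝒲)
    {V : ℕ} (ζ : Fin V → SeedBag S n m) : Fin p → Fin n → ℝ := fun l i ↦
  (1 / ∑ v, outOfBag i (ζ v)) * ∑ v, outOfBag i (ζ v) * bagPrediction F D l i (ζ v)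

/-- The idealised cross-bagged predictions: the conditional expectation
`E[F_l(D(B), s)(x_i) | i ∉ B]` under the law of the seed-and-bag pairs. -/
def crossBaggedLimit (F : Fin p → RegressionAlgorithm 𝒳 𝒲 S) (D : Fin n → 𝒳 × 𝒲)
    (m : ℕ) : Fin p → Fin n → ℝ := fun l i ↦
  (∫ c, outOfBag i c * bagPrediction F D l i c ∂(seedBagLaw S n m)) /
    ∫ c, outOfBag i c ∂(seedBagLaw S n m)

/-- The partial derivative `∂ψ(η)/∂η_{l,i}`. -/
def partialDeriv (ψ : (Fin p → Fin n → ℝ) → ℝ) (η : Fin p → Fin n → ℝ)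
    (l : Fin p) (i : Fin n) : ℝ :=
  fderiv ℝ ψ η (Pi.single l (Pi.single i 1))

/-- The gradient-based out-of-bag variance estimator `τ̂²`. -/
def tauHatSq (ψ : (Fin p → Fin n → ℝ) → ℝ) (F : Fin p → RegressionAlgorithm 𝒳 𝒲 S)
    (D : Fin n → 𝒳 × 𝒲) {V : ℕ} (ζ : Fin V → SeedBag S n m) : ℝ :=
  1 / (V * (1 - (m : ℝ) / n) ^ 2) *
    ∑ v, (∑ l, ∑ i, partialDeriv ψ (crossBagged F D ζ) l i *
      (outOfBag i (ζ v) * (bagPrediction F D l i (ζ v) - crossBagged F D ζ l i))) ^ 2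

end CrossBagging

end

/-!
Write `q = 1 - m / n > 0` for the probability that a random bag leaves out a given observation
(`integral_outOfBag`). Because `η^∞_{l,i}` is a conditional mean given `i ∉ B`, the out-of-bag
residuals `1[i ∉ B] (F_l(D(B), s)(x_i) - η^∞_{l,i})` are centred (`integral_outOfBagResidual`), and
the cross-bagged predictions satisfy
`V^{1/2} (η_{l,i} - η^∞_{l,i}) = (C_i / V)⁻¹ V^{-1/2} ∑_v (residual of the pair v)`
as soon as `C_i ≠ 0`, where `C_i / V → q` almost surely. The delta method then replaces
`V^{1/2} (Ψ(η) - Ψ(η^∞))` by the normalized sum of the i.i.d. centred variables `influence`, that is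
`q⁻¹ ∑_{l,i} ∂_{l,i}Ψ(η^∞) (residual)`. The error of this replacement is at most a sum of products of
normalized residual sums with weights that tend to `0` almost surely
(`abs_linearizationError_le`), so it vanishes in probability
(`tendstoInMeasure_linearizationError`). Hence the one-dimensional central limit theorem applies to
`influence`, and `τ²` is the second moment of `influence`.

For two independent sequences the two normalized statistics are independent for each `V`, so their
difference is asymptotically Gaussian with the sum of the variances
(`tendstoInDistribution_gaussianReal_sub`). Finally, `τ̂²` is the average over the draws of the square
of `influence` with `η^∞` replaced by `η`. As the seed-and-bag pairs live in a finite space, such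
averages converge almost surely, even when the integrand varies with `V`, by the law of large numbers
for the empirical frequencies (`ae_tendsto_average_draws`).
-/

namespace CrossBagging

/-! ### Convergence in probability to zero -/

section InMeasure

variable {Ω : Type*} [MeasurableSpace Ω] {P : Measure Ω} {f g : ℕ → Ω → ℝ}

lemma tendstoInMeasure_zero_of_abs_le (hg : TendstoInMeasure P g atTop fun _ ↦ 0)
    (hfg : ∀ k ω, |f k ω| ≤ |g k ω|) : TendstoInMeasure P f atTop fun _ ↦ 0 := by
  rw [tendstoInMeasure_iff_norm] at hg ⊢
  intro ε hε
  refine tendsto_of_tendsto_of_tendsto_of_le_of_le tendsto_const_nhds (hg ε hε)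
    (fun _ ↦ zero_le) fun k ↦ measure_mono fun ω hω ↦ ?_
  simp only [sub_zero, Real.norm_eq_abs, Set.mem_ofPred_eq] at hω ⊢
  exact hω.trans (hfg k ω)

lemma tendstoInMeasure_zero_add (hf : TendstoInMeasure P f atTop fun _ ↦ 0)
    (hg : TendstoInMeasure P g atTop fun _ ↦ 0) :
    TendstoInMeasure P (fun k ω ↦ f k ω + g k ω) atTop fun _ ↦ 0 := by
  rw [tendstoInMeasure_iff_norm] at hf hg ⊢
  intro ε hε
  have h := (hf (ε / 2) (by positivity)).add (hg (ε / 2) (by positivity))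
  rw [add_zero] at h
  refine tendsto_of_tendsto_of_tendsto_of_le_of_le tendsto_const_nhds h
    (fun _ ↦ zero_le) fun k ↦ (measure_mono fun ω hω ↦ ?_).trans (measure_union_le _ _)
  simp only [sub_zero, Real.norm_eq_abs, Set.mem_ofPred_eq, Set.mem_union] at hω ⊢
  by_contra! hlt
  linarith [abs_add_le (f k ω) (g k ω)]

lemma tendstoInMeasure_zero_sum {ι : Type*} (s : Finset ι) {f : ι → ℕ → Ω → ℝ}
    (hf : ∀ j ∈ s, TendstoInMeasure P (f j) atTop fun _ ↦ 0) :
    TendstoInMeasure P (fun k ω ↦ ∑ j ∈ s, f j k ω) atTop fun _ ↦ 0 := by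
  classical
  induction s using Finset.induction_on with
  | empty =>
    simp only [Finset.sum_empty]
    intro ε hε
    simp [hε.ne']
  | insert a s ha ih =>
    simp only [Finset.sum_insert ha]
    exact tendstoInMeasure_zero_add (hf a (by simp)) (ih fun j hj ↦ hf j (by simp [hj]))

/-- Domination that holds only from some random index on, almost surely, is enough for convergence
to zero in probability. -/
lemma tendstoInMeasure_zero_of_eventually_abs_le [IsFiniteMeasure P]
    (hfm : ∀ k, AEMeasurable (f k) P) (hgm : ∀ k, AEMeasurable (g k) P)
    (hg : TendstoInMeasure P g atTop fun _ ↦ 0)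
    (hfg : ∀ᵐ ω ∂P, ∀ᶠ k in atTop, |f k ω| ≤ g k ω) :
    TendstoInMeasure P f atTop fun _ ↦ 0 := by
  -- The excess of `|f k|` over `g k` is eventually zero almost surely.
  have hexcess : TendstoInMeasure P (fun k ω ↦ max (|f k ω| - g k ω) 0) atTop fun _ ↦ 0 := by
    refine tendstoInMeasure_of_tendsto_ae (fun k ↦ ?_) ?_
    · have := hfm k
      have := hgm k
      exact AEMeasurable.aestronglyMeasurable (by fun_prop)
    · filter_upwards [hfg] with ω hω
      refine tendsto_const_nhds.congr' ?_
      filter_upwards [hω] with k hk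
      rw [max_eq_right (by linarith)]
  refine tendstoInMeasure_zero_of_abs_le (tendstoInMeasure_zero_add hg hexcess) fun k ω ↦ ?_
  refine le_trans ?_ (le_abs_self _)
  linarith [le_max_left (|f k ω| - g k ω) 0]

/-- Convergence in distribution to a constant implies convergence in probability. -/
lemma tendstoInMeasure_of_tendstoInDistribution_const [IsProbabilityMeasure P]
    {Ω' : Type*} [MeasurableSpace Ω'] {P' : Measure Ω'} [IsProbabilityMeasure P'] {c : ℝ}
    (h : TendstoInDistribution f atTop (fun _ : Ω' ↦ c) (fun _ ↦ P) P') :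
    TendstoInMeasure P f atTop fun _ ↦ c := by
  rw [tendstoInMeasure_iff_norm]
  intro ε hε
  have hcl : IsClosed {x : ℝ | ε ≤ ‖x - c‖} := isClosed_le (by fun_prop) (by fun_prop)
  have hc : c ∉ {x : ℝ | ε ≤ ‖x - c‖} := by simpa using hε
  have h0 := ProbabilityMeasure.tendsto_measure_of_null_frontier_of_tendsto' h.tendsto
    (E := {x : ℝ | ε ≤ ‖x - c‖}) (by
      simp only [ProbabilityMeasure.coe_mk, Measure.map_const, measure_univ, one_smul]
      rw [Measure.dirac_apply' _ isClosed_frontier.measurableSet]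
      exact Set.indicator_of_notMem (fun hmem ↦ hc (hcl.frontier_subset hmem)) _)
  simp only [ProbabilityMeasure.coe_mk, Measure.map_const, measure_univ, one_smul] at h0
  rw [Measure.dirac_apply' _ hcl.measurableSet, Set.indicator_of_notMem hc] at h0
  refine h0.congr fun k ↦ ?_
  rw [Measure.map_apply_of_aemeasurable (h.forall_aemeasurable k) hcl.measurableSet]
  rfl

/-- A sequence converging in distribution times one tending to zero in probability tends to zero in
probability. -/
lemma tendstoInMeasure_zero_mul [IsProbabilityMeasure P]
    {Ω' : Type*} [MeasurableSpace Ω'] {P' : Measure Ω'} [IsProbabilityMeasure P'] {Z : Ω' → ℝ}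
    (hf : TendstoInDistribution f atTop Z (fun _ ↦ P) P')
    (hg : TendstoInMeasure P g atTop fun _ ↦ 0) (hgm : ∀ k, AEMeasurable (g k) P) :
    TendstoInMeasure P (fun k ω ↦ f k ω * g k ω) atTop fun _ ↦ 0 := by
  refine tendstoInMeasure_of_tendstoInDistribution_const (P' := P') ?_
  simpa using hf.continuous_comp_prodMk_of_tendstoInMeasure_const
    (g := fun x : ℝ × ℝ ↦ x.1 * x.2) (by fun_prop) hg hgm

end InMeasure

/-! ### Differences of independent asymptotically Gaussian variables -/

lemma tendstoInDistribution_gaussianReal_sub {Ω : Type*} [MeasurableSpace Ω] {P : Measure Ω}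
    [IsProbabilityMeasure P] {f g : ℕ → Ω → ℝ} {a b : ℝ≥0}
    (hf : TendstoInDistribution f atTop id (fun _ ↦ P) (gaussianReal 0 a))
    (hg : TendstoInDistribution g atTop id (fun _ ↦ P) (gaussianReal 0 b))
    (hfg : ∀ k, IndepFun (f k) (g k) P) :
    TendstoInDistribution (fun k ω ↦ f k ω - g k ω) atTop id (fun _ ↦ P)
      (gaussianReal 0 (a + b)) where
  forall_aemeasurable k := (hf.forall_aemeasurable k).sub (hg.forall_aemeasurable k)
  aemeasurable_limit := aemeasurable_id
  tendsto := by
    refine ProbabilityMeasure.tendsto_iff_tendsto_charFun.2 fun t ↦ ?_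
    have hneg := hg.continuous_comp continuous_neg
    have h := (ProbabilityMeasure.tendsto_iff_tendsto_charFun.1 hf.tendsto t).mul
      (ProbabilityMeasure.tendsto_iff_tendsto_charFun.1 hneg.tendsto t)
    simp only [ProbabilityMeasure.coe_mk, Function.comp_id, Measure.map_id, charFun_gaussianReal,
      gaussianReal_map_neg] at h ⊢
    rw [← Complex.exp_add] at h
    convert h using 2 with k
    · have hind : IndepFun (f k) (Neg.neg ∘ g k) P := (hfg k).comp measurable_id measurable_neg
      simp only [sub_eq_add_neg]
      exact congrFun (hind.charFun_map_add_eq_mul (hf.forall_aemeasurable k)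
        (hneg.forall_aemeasurable k)) t
    · push_cast
      ring_nf

/-! ### Independent draws from a law on a finite space -/

section Draws

variable {C : Type*} [MeasurableSpace C] [Finite C] [MeasurableSingletonClass C] {μ : Measure C}
  {Ω : Type*} [MeasurableSpace Ω] {P : Measure Ω} {ζ : ℕ → Ω → C}

lemma aemeasurable_comp_draws (hζ : ∀ v, HasLaw (ζ v) μ P) {V : ℕ} {β : Type*} [MeasurableSpace β]
    (g : (Fin V → C) → β) : AEMeasurable (fun ω ↦ g fun v ↦ ζ v ω) P :=
  (Measurable.of_discrete (f := g)).comp_aemeasurable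
    (aemeasurable_pi_lambda _ fun v ↦ (hζ v).aemeasurable)

lemma identDistrib_comp_draws (hζ : ∀ v, HasLaw (ζ v) μ P) (f : C → ℝ) (v : ℕ) :
    IdentDistrib (fun ω ↦ f (ζ v ω)) (fun ω ↦ f (ζ 0 ω)) P P :=
  IdentDistrib.comp (u := f)
    ⟨(hζ v).aemeasurable, (hζ 0).aemeasurable, (hζ v).map_eq.trans (hζ 0).map_eq.symm⟩
    Measurable.of_discrete

lemma integral_comp_draws (hζ : ∀ v, HasLaw (ζ v) μ P) (f : C → ℝ) (v : ℕ) :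
    ∫ ω, f (ζ v ω) ∂P = ∫ c, f c ∂μ :=
  (hζ v).integral_comp (f := f) Measurable.of_discrete.aestronglyMeasurable

/-- Almost surely, averages of a function over the draws converge to its mean, simultaneously for
all functions, and even if the function varies along a pointwise convergent sequence: on a finite
space all such averages are governed by the empirical frequencies. -/
lemma ae_tendsto_average_draws [IsProbabilityMeasure μ] (hζ : ∀ v, HasLaw (ζ v) μ P)
    (hind : iIndepFun ζ P) :
    ∀ᵐ ω ∂P, ∀ (f : C → ℝ) (fs : ℕ → C → ℝ), (∀ c, Tendsto (fun V ↦ fs V c) atTop (𝓝 (f c))) →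
      Tendsto (fun V : ℕ ↦ (∑ v : Fin V, fs V (ζ v ω)) / V) atTop (𝓝 (∫ c, f c ∂μ)) := by
  classical
  have := Fintype.ofFinite C
  have hfreq : ∀ᵐ ω ∂P, ∀ c, Tendsto
      (fun V : ℕ ↦ (∑ v ∈ Finset.range V, if ζ v ω = c then (1 : ℝ) else 0) / V) atTop
      (𝓝 (μ.real {c})) := by
    refine ae_all_iff.2 fun c ↦ ?_
    have h := strong_law_ae_real (fun v ω ↦ (fun x ↦ if x = c then (1 : ℝ) else 0) (ζ v ω))
      (by
        refine (integrable_map_measure (f := ζ 0) (g := fun x ↦ if x = c then (1 : ℝ) else 0)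
          Measurable.of_discrete.aestronglyMeasurable (hζ 0).aemeasurable).1 ?_
        rw [(hζ 0).map_eq]
        exact .of_finite)
      (fun v w hvw ↦ (hind.comp (fun _ x ↦ if x = c then (1 : ℝ) else 0)
        fun _ ↦ Measurable.of_discrete).indepFun hvw)
      (identDistrib_comp_draws hζ fun x ↦ if x = c then (1 : ℝ) else 0)
    have hint : ∫ ω, (if ζ 0 ω = c then (1 : ℝ) else 0) ∂P = μ.real {c} := by
      rw [integral_comp_draws hζ (fun x ↦ if x = c then (1 : ℝ) else 0) 0,
        integral_fintype .of_finite]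
      simp
    rw [hint] at h
    exact h
  filter_upwards [hfreq] with ω hω f fs hfs
  rw [integral_fintype .of_finite]
  refine (tendsto_finsetSum Finset.univ fun c _ ↦ (hω c).mul (hfs c)).congr fun V ↦ ?_
  rw [Fin.sum_univ_eq_sum_range (fun v ↦ fs V (ζ v ω)), Finset.sum_div]
  simp_rw [Finset.sum_div, Finset.sum_mul]
  rw [Finset.sum_comm]
  refine Finset.sum_congr rfl fun v _ ↦ ?_
  rw [Finset.sum_eq_single (ζ v ω)]
  · simp
    ring
  · intro c _ hc
    simp [hc.symm]
  · simp

/-- The central limit theorem for a centred function of the draws. -/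
lemma tendstoInDistribution_sum_draws [IsProbabilityMeasure μ] [IsProbabilityMeasure P]
    (hζ : ∀ v, HasLaw (ζ v) μ P) (hind : iIndepFun ζ P) {f : C → ℝ} (hf : ∫ c, f c ∂μ = 0) :
    TendstoInDistribution (fun (V : ℕ) ω ↦ (√(V : ℝ))⁻¹ * ∑ v : Fin V, f (ζ v ω)) atTop id
      (fun _ ↦ P) (gaussianReal 0 (∫ c, f c ^ 2 ∂μ).toNNReal) := by
  have hmean : P[fun ω ↦ f (ζ 0 ω)] = 0 := (integral_comp_draws hζ f 0).trans hf
  have hmeas : AEMeasurable (fun ω ↦ f (ζ 0 ω)) P :=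
    (identDistrib_comp_draws hζ f 0).aemeasurable_fst
  have hvar : Var[fun ω ↦ f (ζ 0 ω); P] = ∫ c, f c ^ 2 ∂μ := by
    rw [variance_eq_integral hmeas, hmean, ← integral_comp_draws hζ (fun c ↦ f c ^ 2) 0]
    simp
  have hL2 : MemLp (fun ω ↦ f (ζ 0 ω)) 2 P := by
    have : MemLp f 2 (P.map (ζ 0)) := by
      rw [(hζ 0).map_eq]
      exact MemLp.of_discrete
    exact this.comp_of_map (hζ 0).aemeasurable
  have h := tendstoInDistribution_inv_sqrt_mul_sum_sub (P := P) (X := fun v ω ↦ f (ζ v ω))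
    (Y := id) (P' := gaussianReal 0 (∫ c, f c ^ 2 ∂μ).toNNReal) (by
      rw [hvar]; exact HasLaw.id) hL2
    (hind.comp (fun _ ↦ f) fun _ ↦ Measurable.of_discrete) (identDistrib_comp_draws hζ f)
  simp only [hmean, mul_zero, sub_zero] at h
  convert h using 4 with V ω
  exact Fin.sum_univ_eq_sum_range (fun v ↦ f (ζ v ω)) V

/-- Statistics of two sequences of draws that are jointly independent are independent. -/
lemma indepFun_draws {ζ' : ℕ → Ω → C} (hζ : ∀ v, HasLaw (ζ v) μ P) (hζ' : ∀ v, HasLaw (ζ' v) μ P)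
    (hind : iIndepFun (Sum.elim ζ ζ') P) {V : ℕ} (f g : (Fin V → C) → ℝ) :
    IndepFun (fun ω ↦ f fun v ↦ ζ v ω) (fun ω ↦ g fun v ↦ ζ' v ω) P := by
  classical
  let s : Finset (ℕ ⊕ ℕ) := Finset.univ.image fun v : Fin V ↦ Sum.inl (v : ℕ)
  let t : Finset (ℕ ⊕ ℕ) := Finset.univ.image fun v : Fin V ↦ Sum.inr (v : ℕ)
  have hst : Disjoint s t := by
    simp [s, t, Finset.disjoint_left]
  have h := hind.indepFun_finset₀ s t hst (by
    rintro (v | v)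
    · exact (hζ v).aemeasurable
    · exact (hζ' v).aemeasurable)
  exact h.comp
    (φ := fun x : s → C ↦ f fun v ↦ x ⟨Sum.inl (v : ℕ), by simp [s]⟩)
    (ψ := fun x : t → C ↦ g fun v ↦ x ⟨Sum.inr (v : ℕ), by simp [t]⟩)
    Measurable.of_discrete Measurable.of_discrete

end Draws

/-! ### The out-of-bag probability -/

section Law

variable {𝒳 𝒲 : Type*} {S n m p : ℕ}

lemma one_sub_div_pos (hmn : m < n) : 0 < 1 - (m : ℝ) / n := by
  have hn : (0 : ℝ) < n := by exact_mod_cast (Nat.zero_le m).trans_lt hmn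
  rw [sub_pos, div_lt_one hn]
  exact_mod_cast hmn

lemma isProbabilityMeasure_seedBagLaw (hS : 1 ≤ S) (hmn : m ≤ n) :
    IsProbabilityMeasure (seedBagLaw S n m) := by
  have : Nonempty (Fin S) := ⟨⟨0, hS⟩⟩
  have : Nonempty (Bag n m) := by
    obtain ⟨B, -, hB⟩ := Finset.exists_subset_card_eq (s := (Finset.univ : Finset (Fin n)))
      (n := m) (by simpa using hmn)
    exact ⟨⟨B, hB⟩⟩
  unfold seedBagLaw
  infer_instance

lemma bagSize_lt {ρ : ℝ} (hρ1 : ρ < 1) (hm : 1 ≤ bagSize ρ n) : bagSize ρ n < n := by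
  have hn : 0 < n := by
    rcases Nat.eq_zero_or_pos n with rfl | h
    · simp [bagSize] at hm
    · exact h
  have hn' : (0 : ℝ) < n := by exact_mod_cast hn
  unfold bagSize
  rw [Nat.floor_lt' hn.ne']
  nlinarith

/-- The bags leaving out `i` are the `m`-element subsets of the other `n - 1` observations. -/
lemma card_bag_filter_notMem (i : Fin n) :
    (Finset.univ.filter fun B : Bag n m ↦ i ∉ B.1).card = (n - 1).choose m := by
  have h : (Finset.powersetCard m ((Finset.univ : Finset (Fin n)).erase i)).card =
      (n - 1).choose m := by simp
  rw [← h]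
  refine Finset.card_bij (fun B _ ↦ B.1) (fun B hB ↦ ?_) (fun _ _ _ _ h ↦ Subtype.ext h)
    fun B hB ↦ ?_
  · rw [Finset.mem_powersetCard]
    refine ⟨fun j hj ↦ ?_, B.2⟩
    have hi : i ∉ B.1 := (Finset.mem_filter.1 hB).2
    simp only [Finset.mem_erase, Finset.mem_univ, and_true]
    rintro rfl
    exact hi hj
  · rw [Finset.mem_powersetCard] at hB
    refine ⟨⟨B, hB.2⟩, Finset.mem_filter.2 ⟨Finset.mem_univ _, fun hi ↦ ?_⟩, rfl⟩
    simpa using hB.1 hi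

/-- An observation is left out of a random bag with probability `1 - m / n`. -/
lemma integral_outOfBag (hS : 1 ≤ S) (hmn : m < n) (i : Fin n) :
    ∫ c, outOfBag i c ∂(seedBagLaw S n m) = 1 - (m : ℝ) / n := by
  have : Nonempty (Fin S) := ⟨⟨0, hS⟩⟩
  have h1 : ∫ c, outOfBag i c ∂(seedBagLaw S n m) =
      ∫ B : Bag n m, (if i ∈ B.1 then (0 : ℝ) else 1) ∂uniformOn Set.univ := by
    unfold seedBagLaw outOfBag
    rw [integral_fun_snd (μ := uniformOn (Set.univ : Set (Fin S)))
      (fun B : Bag n m ↦ if i ∈ B.1 then (0 : ℝ) else 1)]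
    simp
  have hcard : Fintype.card (Bag n m) = n.choose m := by
    rw [Fintype.card_finset_len, Fintype.card_fin]
  have h2 : (fun B : Bag n m ↦ if i ∈ B.1 then (0 : ℝ) else 1) =
      Set.indicator {B : Bag n m | i ∉ B.1} 1 := by
    ext B
    by_cases hi : i ∈ B.1 <;> simp [hi]
  have hset : {B : Bag n m | i ∉ B.1} = ↑(Finset.univ.filter fun B : Bag n m ↦ i ∉ B.1) := by
    ext; simp
  rw [h1, h2, integral_indicator_one .of_discrete, measureReal_def, uniformOn_univ, hset,
    Measure.count_apply_finset, card_bag_filter_notMem, hcard, ENNReal.toReal_div,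
    ENNReal.toReal_natCast, ENNReal.toReal_natCast]
  obtain ⟨k, rfl⟩ : ∃ k, n = k + 1 := ⟨n - 1, by omega⟩
  have hch := Nat.choose_mul_succ_eq k m
  have hpos : (0 : ℝ) < ((k + 1).choose m : ℕ) := by
    exact_mod_cast Nat.choose_pos hmn.le
  have hch' : (k.choose m : ℝ) * (k + 1) = ((k + 1).choose m : ℕ) * ((k : ℝ) + 1 - m) := by
    have := congrArg (Nat.cast : ℕ → ℝ) hch
    rw [Nat.cast_mul, Nat.cast_mul, Nat.cast_sub hmn.le] at this
    exact_mod_cast this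
  have hk : (0 : ℝ) < (k : ℝ) + 1 := by positivity
  rw [Nat.add_sub_cancel]
  push_cast
  rw [div_eq_iff hpos.ne']
  field_simp
  linarith

end Law

/-! ### Linearization of the cross-bagged statistic -/

section Linearization

variable {𝒳 𝒲 : Type*} {S n m p : ℕ}
  (F : Fin p → RegressionAlgorithm 𝒳 𝒲 S) (D : Fin n → 𝒳 × 𝒲)

/-- The out-of-bag prediction error `1[i ∉ B] (F_l(D(B), s)(x_i) - η_{l,i})` of a pair `(s, B)`
relative to a matrix `η`. -/
noncomputable def outOfBagResidual (η : Fin p → Fin n → ℝ) (l : Fin p) (i : Fin n)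
    (c : SeedBag S n m) : ℝ :=
  outOfBag i c * (bagPrediction F D l i c - η l i)

/-- The influence function of one seed-and-bag pair on `ψ` of the cross-bagged predictions. -/
noncomputable def influence (ψ : (Fin p → Fin n → ℝ) → ℝ) (c : SeedBag S n m) : ℝ :=
  (1 - (m : ℝ) / n)⁻¹ * ∑ l, ∑ i, partialDeriv ψ (crossBaggedLimit F D m) l i *
    outOfBagResidual F D (crossBaggedLimit F D m) l i c

/-- The normalized sum `V^{-1/2} ∑_v 1[i ∉ B^v] (F_l(D(B^v), s_v)(x_i) - η^∞_{l,i})`. -/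
noncomputable def residualSum {V : ℕ} (z : Fin V → SeedBag S n m) (l : Fin p) (i : Fin n) : ℝ :=
  (√(V : ℝ))⁻¹ * ∑ v, outOfBagResidual F D (crossBaggedLimit F D m) l i (z v)

/-- The absolute first-order Taylor remainder of `ψ` at `η₀`, divided by the distance to `η₀` (and
`0` at `η₀` itself). -/
noncomputable def relRemainder (ψ : (Fin p → Fin n → ℝ) → ℝ) (η₀ η : Fin p → Fin n → ℝ) : ℝ :=
  |ψ η - ψ η₀ - fderiv ℝ ψ η₀ (η - η₀)| / ‖η - η₀‖

/-- The error of the linearization of `ψ` of the cross-bagged predictions, at scale `V^{1/2}`. -/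
noncomputable def linearizationError (ψ : (Fin p → Fin n → ℝ) → ℝ) {V : ℕ}
    (z : Fin V → SeedBag S n m) : ℝ :=
  √(V : ℝ) * (ψ (crossBagged F D z) - ψ (crossBaggedLimit F D m)) -
    (√(V : ℝ))⁻¹ * ∑ v, influence F D ψ (z v)

/-- The weight with which `residualSum` enters the bound on the linearization error: one part comes
from replacing the random fraction `C_i / V` by its limit, the other from the Taylor remainder. -/
noncomputable def errorWeight (ψ : (Fin p → Fin n → ℝ) → ℝ) {V : ℕ} (z : Fin V → SeedBag S n m)
    (l : Fin p) (i : Fin n) : ℝ :=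
  |partialDeriv ψ (crossBaggedLimit F D m) l i| *
      |((∑ v, outOfBag i (z v)) / V)⁻¹ - (1 - (m : ℝ) / n)⁻¹| +
    |((∑ v, outOfBag i (z v)) / V)⁻¹| *
      relRemainder ψ (crossBaggedLimit F D m) (crossBagged F D z)

variable {F D}

lemma integral_outOfBagResidual (hS : 1 ≤ S) (hmn : m < n) (l : Fin p) (i : Fin n) :
    ∫ c, outOfBagResidual F D (crossBaggedLimit F D m) l i c ∂(seedBagLaw S n m) = 0 := by
  have := isProbabilityMeasure_seedBagLaw hS hmn.le
  have hq : ∫ c, outOfBag i c ∂(seedBagLaw S n m) ≠ 0 := by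
    rw [integral_outOfBag hS hmn]
    exact (one_sub_div_pos hmn).ne'
  simp only [outOfBagResidual, mul_sub]
  rw [integral_sub .of_finite .of_finite, integral_mul_const]
  simp only [crossBaggedLimit]
  rw [mul_div_cancel₀ _ hq, sub_self]

lemma integral_influence (hS : 1 ≤ S) (hmn : m < n) (ψ : (Fin p → Fin n → ℝ) → ℝ) :
    ∫ c, influence F D ψ c ∂(seedBagLaw S n m) = 0 := by
  have := isProbabilityMeasure_seedBagLaw hS hmn.le
  simp only [influence]
  rw [integral_const_mul, integral_finsetSum _ fun _ _ ↦ .of_finite]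
  simp_rw [integral_finsetSum _ fun _ _ ↦ Integrable.of_finite, integral_const_mul,
    integral_outOfBagResidual hS hmn]
  simp

lemma tendsto_relRemainder {ψ : (Fin p → Fin n → ℝ) → ℝ} {η₀ : Fin p → Fin n → ℝ}
    (hψ : DifferentiableAt ℝ ψ η₀) : Tendsto (relRemainder ψ η₀) (𝓝 η₀) (𝓝 0) := by
  have h := hψ.hasFDerivAt.isLittleO.norm_norm.tendsto_div_nhds_zero
  simp only [Real.norm_eq_abs] at h
  exact h

lemma norm_le_sum_abs (d : Fin p → Fin n → ℝ) : ‖d‖ ≤ ∑ l, ∑ i, |d l i| := by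
  refine (pi_norm_le_iff_of_nonneg (by positivity)).2 fun l ↦
    (pi_norm_le_iff_of_nonneg (by positivity)).2 fun i ↦ ?_
  exact (Finset.single_le_sum (f := fun i ↦ |d l i|) (fun _ _ ↦ abs_nonneg _)
    (Finset.mem_univ i)).trans
    (Finset.single_le_sum (f := fun l ↦ ∑ i, |d l i|) (fun _ _ ↦ by positivity)
      (Finset.mem_univ l))

lemma fderiv_apply_eq_sum_partialDeriv (ψ : (Fin p → Fin n → ℝ) → ℝ) (η d : Fin p → Fin n → ℝ) :
    fderiv ℝ ψ η d = ∑ l, ∑ i, partialDeriv ψ η l i * d l i := by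
  have hd : d = ∑ l, ∑ i, d l i • (Pi.single l (Pi.single i 1) : Fin p → Fin n → ℝ) := by
    ext l i
    simp [Finset.sum_apply, Pi.single_apply, ite_apply, Finset.sum_ite_eq]
  conv_lhs => rw [hd]
  simp [partialDeriv, mul_comm]

/-- If every observation is out of some bag, the normalized deviation of the cross-bagged
predictions is the ratio of `residualSum` to the fraction of bags leaving out the observation. -/
lemma sqrt_mul_crossBagged_sub {V : ℕ} {z : Fin V → SeedBag S n m} {i : Fin n}
    (hz : ∑ v, outOfBag i (z v) ≠ 0) (l : Fin p) :
    √(V : ℝ) * (crossBagged F D z l i - crossBaggedLimit F D m l i) =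
      ((∑ v, outOfBag i (z v)) / V)⁻¹ * residualSum F D z l i := by
  have hV : (0 : ℝ) < V := by
    rcases Nat.eq_zero_or_pos V with rfl | h
    · simp at hz
    · exact_mod_cast h
  have hsq : √(V : ℝ) ≠ 0 := (Real.sqrt_pos.2 hV).ne'
  have hVV : (V : ℝ) = √(V : ℝ) * √(V : ℝ) := (Real.mul_self_sqrt hV.le).symm
  simp only [residualSum, outOfBagResidual, mul_sub, Finset.sum_sub_distrib, ← Finset.sum_mul]
  rw [crossBagged]
  generalize crossBaggedLimit F D m l i = a
  generalize ∑ v, outOfBag i (z v) * bagPrediction F D l i (z v) = b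
  generalize ∑ v, outOfBag i (z v) = s at hz
  generalize √(V : ℝ) = r at hsq hVV
  rw [inv_div, hVV]
  field_simp

/-- The linearization error is small relative to the normalized residual sums. -/
lemma abs_linearizationError_le (ψ : (Fin p → Fin n → ℝ) → ℝ) {V : ℕ} {z : Fin V → SeedBag S n m}
    (hz : ∀ i, ∑ v, outOfBag i (z v) ≠ 0) :
    |linearizationError F D ψ z| ≤
      ∑ l, ∑ i, |residualSum F D z l i| * errorWeight F D ψ z l i := by
  set η₀ := crossBaggedLimit F D m with hη₀
  set d := crossBagged F D z - η₀ with hd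
  have hdev : ∀ l i, √(V : ℝ) * d l i =
      ((∑ v, outOfBag i (z v)) / V)⁻¹ * residualSum F D z l i := fun l i ↦
    sqrt_mul_crossBagged_sub (hz i) l
  set rem := ψ (crossBagged F D z) - ψ η₀ - fderiv ℝ ψ η₀ d with hrem
  have hrel : |rem| = relRemainder ψ η₀ (crossBagged F D z) * ‖d‖ := by
    -- At distance zero the quotient is `0 / 0 = 0`, and the remainder vanishes as well.
    rcases eq_or_ne ‖d‖ 0 with h0 | h0
    · have hd0 : d = 0 := norm_eq_zero.1 h0
      have : crossBagged F D z = η₀ := sub_eq_zero.1 hd0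
      simp [hrem, hd0, this]
    · rw [relRemainder, div_mul_cancel₀ _ h0]
  have hrel0 : 0 ≤ relRemainder ψ η₀ (crossBagged F D z) := by
    unfold relRemainder; positivity
  have hinfl : (√(V : ℝ))⁻¹ * ∑ v, influence F D ψ (z v) =
      ∑ l, ∑ i, partialDeriv ψ η₀ l i * ((1 - (m : ℝ) / n)⁻¹ * residualSum F D z l i) := by
    simp only [influence, residualSum]
    rw [← Finset.mul_sum, Finset.sum_comm, Finset.mul_sum, Finset.mul_sum]
    refine Finset.sum_congr rfl fun l _ ↦ ?_
    rw [Finset.sum_comm, Finset.mul_sum, Finset.mul_sum]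
    refine Finset.sum_congr rfl fun i _ ↦ ?_
    rw [← Finset.mul_sum]
    ring
  have hlin : √(V : ℝ) * fderiv ℝ ψ η₀ d = ∑ l, ∑ i, partialDeriv ψ η₀ l i *
      (((∑ v, outOfBag i (z v)) / V)⁻¹ * residualSum F D z l i) := by
    rw [fderiv_apply_eq_sum_partialDeriv, Finset.mul_sum]
    refine Finset.sum_congr rfl fun l _ ↦ ?_
    rw [Finset.mul_sum]
    refine Finset.sum_congr rfl fun i _ ↦ ?_
    rw [← hdev]
    ring
  have hsplit : linearizationError F D ψ z = ∑ l, ∑ i, partialDeriv ψ η₀ l i *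
      ((((∑ v, outOfBag i (z v)) / V)⁻¹ - (1 - (m : ℝ) / n)⁻¹) * residualSum F D z l i) +
      √(V : ℝ) * rem := by
    have : linearizationError F D ψ z = (√(V : ℝ) * fderiv ℝ ψ η₀ d -
        (√(V : ℝ))⁻¹ * ∑ v, influence F D ψ (z v)) + √(V : ℝ) * rem := by
      simp only [linearizationError, hrem]
      ring
    rw [this, hlin, hinfl]
    simp only [← Finset.sum_sub_distrib, sub_mul, mul_sub]
  have hsqrt : √(V : ℝ) * ‖d‖ ≤
      ∑ l, ∑ i, |((∑ v, outOfBag i (z v)) / V)⁻¹| * |residualSum F D z l i| := by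
    refine (mul_le_mul_of_nonneg_left (norm_le_sum_abs d) (Real.sqrt_nonneg _)).trans_eq ?_
    simp only [Finset.mul_sum]
    refine Finset.sum_congr rfl fun l _ ↦ Finset.sum_congr rfl fun i _ ↦ ?_
    rw [← abs_mul, ← hdev, abs_mul, abs_of_nonneg (Real.sqrt_nonneg _)]
  have hremle : |√(V : ℝ) * rem| ≤ ∑ l, ∑ i, |((∑ v, outOfBag i (z v)) / V)⁻¹| *
      |residualSum F D z l i| * relRemainder ψ η₀ (crossBagged F D z) := by
    simp only [← Finset.sum_mul]
    rw [abs_mul, abs_of_nonneg (Real.sqrt_nonneg _), hrel, mul_left_comm, mul_comm]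
    exact mul_le_mul_of_nonneg_right hsqrt hrel0
  rw [hsplit]
  refine (abs_add_le _ _).trans ((add_le_add ((Finset.abs_sum_le_sum_abs _ _).trans
    (Finset.sum_le_sum fun l _ ↦ Finset.abs_sum_le_sum_abs _ _)) hremle).trans_eq ?_)
  simp only [← Finset.sum_add_distrib]
  refine Finset.sum_congr rfl fun l _ ↦ Finset.sum_congr rfl fun i _ ↦ ?_
  rw [abs_mul, abs_mul, errorWeight]
  ring

end Linearization

/-! ### Limits of the cross-bagged statistics -/

section Limits

variable {𝒳 𝒲 : Type*} {S n m p : ℕ}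
  {F : Fin p → RegressionAlgorithm 𝒳 𝒲 S} {D : Fin n → 𝒳 × 𝒲}

/-- Along the sequence `z`, averages of functions (possibly varying along a pointwise convergent
sequence) converge to their means under `seedBagLaw`; almost every sequence of draws is such. -/
def AveragesConverge (z : ℕ → SeedBag S n m) : Prop :=
  ∀ (f : SeedBag S n m → ℝ) (fs : ℕ → SeedBag S n m → ℝ),
    (∀ c, Tendsto (fun V ↦ fs V c) atTop (𝓝 (f c))) →
    Tendsto (fun V : ℕ ↦ (∑ v : Fin V, fs V (z v)) / V) atTop
      (𝓝 (∫ c, f c ∂(seedBagLaw S n m)))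

variable {z : ℕ → SeedBag S n m}

lemma AveragesConverge.tendsto_outOfBag (hz : AveragesConverge z) (hS : 1 ≤ S) (hmn : m < n)
    (i : Fin n) :
    Tendsto (fun V : ℕ ↦ (∑ v : Fin V, outOfBag i (z v)) / V) atTop (𝓝 (1 - (m : ℝ) / n)) := by
  rw [← integral_outOfBag hS hmn i]
  exact hz _ (fun _ ↦ outOfBag i) fun _ ↦ tendsto_const_nhds

lemma AveragesConverge.tendsto_crossBagged (hz : AveragesConverge z) (hS : 1 ≤ S) (hmn : m < n) :
    Tendsto (fun V : ℕ ↦ crossBagged F D fun v : Fin V ↦ z v) atTop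
      (𝓝 (crossBaggedLimit F D m)) := by
  refine tendsto_pi_nhds.2 fun l ↦ tendsto_pi_nhds.2 fun i ↦ ?_
  have h := (hz (fun c ↦ outOfBag i c * bagPrediction F D l i c)
    (fun _ c ↦ outOfBag i c * bagPrediction F D l i c) fun _ ↦ tendsto_const_nhds).div
    (hz.tendsto_outOfBag hS hmn i) (one_sub_div_pos hmn).ne'
  rw [← integral_outOfBag hS hmn i] at h
  refine h.congr fun V ↦ ?_
  rcases Nat.eq_zero_or_pos V with rfl | hV
  · simp [crossBagged]
  · have hV' : (V : ℝ) ≠ 0 := by exact_mod_cast hV.ne'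
    simp only [crossBagged, Pi.div_apply]
    rw [div_div_div_cancel_right₀ hV', one_div, inv_mul_eq_div]

lemma AveragesConverge.eventually_sum_outOfBag_ne_zero (hz : AveragesConverge z) (hS : 1 ≤ S)
    (hmn : m < n) : ∀ᶠ V : ℕ in atTop, ∀ i, ∑ v : Fin V, outOfBag i (z v) ≠ 0 := by
  refine eventually_all.2 fun i ↦ ?_
  filter_upwards [(hz.tendsto_outOfBag hS hmn i).eventually_const_lt (one_sub_div_pos hmn)]
    with V hV h0
  simp [h0] at hV

lemma AveragesConverge.tendsto_errorWeight (hz : AveragesConverge z) (hS : 1 ≤ S) (hmn : m < n)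
    {ψ : (Fin p → Fin n → ℝ) → ℝ} (hψ : DifferentiableAt ℝ ψ (crossBaggedLimit F D m))
    (l : Fin p) (i : Fin n) :
    Tendsto (fun V : ℕ ↦ errorWeight F D ψ (fun v : Fin V ↦ z v) l i) atTop (𝓝 0) := by
  have hinv := (hz.tendsto_outOfBag hS hmn i).inv₀ (one_sub_div_pos hmn).ne'
  have h1 := ((hinv.sub_const (1 - (m : ℝ) / n)⁻¹).abs.const_mul
    |partialDeriv ψ (crossBaggedLimit F D m) l i|).add
    (hinv.abs.mul ((tendsto_relRemainder hψ).comp (hz.tendsto_crossBagged hS hmn)))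
  simp only [sub_self, abs_zero, mul_zero, add_zero] at h1
  exact h1

/-- The variance estimator is an average of squares of functions converging to the influence
function, and so converges along every such sequence. -/
lemma AveragesConverge.tendsto_tauHatSq (hz : AveragesConverge z) (hS : 1 ≤ S) (hmn : m < n)
    {ψ : (Fin p → Fin n → ℝ) → ℝ}
    (hψ : ContinuousAt (fderiv ℝ ψ) (crossBaggedLimit F D m)) :
    Tendsto (fun V : ℕ ↦ tauHatSq ψ F D fun v : Fin V ↦ z v) atTop
      (𝓝 (∫ c, influence F D ψ c ^ 2 ∂(seedBagLaw S n m))) := by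
  have hη := hz.tendsto_crossBagged (F := F) (D := D) hS hmn
  have h := hz (fun c ↦ influence F D ψ c ^ 2)
    (fun V c ↦ ((1 - (m : ℝ) / n)⁻¹ * ∑ l, ∑ i,
      partialDeriv ψ (crossBagged F D fun v : Fin V ↦ z v) l i *
        outOfBagResidual F D (crossBagged F D fun v : Fin V ↦ z v) l i c) ^ 2) fun c ↦ by
      refine Tendsto.pow (Tendsto.const_mul _ (tendsto_finsetSum _ fun l _ ↦
        tendsto_finsetSum _ fun i _ ↦ Tendsto.mul ?_ ?_)) 2
      · exact ((ContinuousLinearMap.apply ℝ ℝ _).continuous.tendsto _).comp (hψ.tendsto.comp hη)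
      · exact (((tendsto_pi_nhds.1 (tendsto_pi_nhds.1 hη l) i).const_sub _).const_mul _)
  refine h.congr fun V ↦ ?_
  simp only [tauHatSq, outOfBagResidual, mul_pow, ← Finset.mul_sum]
  generalize 1 - (m : ℝ) / n = q
  rw [inv_pow, one_div, mul_inv]
  ring

end Limits

section Draws

variable {𝒳 𝒲 : Type*} {S n m p : ℕ}
  {F : Fin p → RegressionAlgorithm 𝒳 𝒲 S} {D : Fin n → 𝒳 × 𝒲}
  {Ω : Type*} [MeasurableSpace Ω] {P : Measure Ω} [IsProbabilityMeasure P]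
  {ζ : ℕ → Ω → SeedBag S n m}

/-- The linearization error vanishes: it is bounded by products of normalized residual sums, which
are bounded in probability by the central limit theorem, and weights that tend to zero. -/
lemma tendstoInMeasure_linearizationError (hS : 1 ≤ S) (hmn : m < n)
    (hζ : ∀ v, HasLaw (ζ v) (seedBagLaw S n m) P) (hind : iIndepFun ζ P)
    {ψ : (Fin p → Fin n → ℝ) → ℝ} (hψ : DifferentiableAt ℝ ψ (crossBaggedLimit F D m)) :
    TendstoInMeasure P (fun (V : ℕ) ω ↦ linearizationError F D ψ fun v : Fin V ↦ ζ v ω) atTop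
      fun _ ↦ 0 := by
  have := isProbabilityMeasure_seedBagLaw hS hmn.le
  have havg : ∀ᵐ ω ∂P, AveragesConverge fun v ↦ ζ v ω := ae_tendsto_average_draws hζ hind
  refine tendstoInMeasure_zero_of_eventually_abs_le
    (g := fun (V : ℕ) ω ↦ ∑ l, ∑ i, |residualSum F D (fun v : Fin V ↦ ζ v ω) l i| *
      errorWeight F D ψ (fun v : Fin V ↦ ζ v ω) l i)
    (fun V ↦ aemeasurable_comp_draws hζ fun z : Fin V → SeedBag S n m ↦
      linearizationError F D ψ z)
    (fun V ↦ aemeasurable_comp_draws hζ fun z : Fin V → SeedBag S n m ↦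
      ∑ l, ∑ i, |residualSum F D z l i| * errorWeight F D ψ z l i) ?_ ?_
  · refine tendstoInMeasure_zero_sum _ fun l _ ↦ tendstoInMeasure_zero_sum _ fun i _ ↦ ?_
    have hclt := (tendstoInDistribution_sum_draws hζ hind
      (integral_outOfBagResidual (F := F) (D := D) hS hmn l i)).continuous_comp continuous_abs
    have hmeas : ∀ V : ℕ,
        AEMeasurable (fun ω ↦ errorWeight F D ψ (fun v : Fin V ↦ ζ v ω) l i) P := fun V ↦
      aemeasurable_comp_draws hζ fun z : Fin V → SeedBag S n m ↦ errorWeight F D ψ z l i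
    refine tendstoInMeasure_zero_mul hclt
      (tendstoInMeasure_of_tendsto_ae (fun V ↦ (hmeas V).aestronglyMeasurable) ?_) hmeas
    filter_upwards [havg] with ω hω
    exact hω.tendsto_errorWeight hS hmn hψ l i
  · filter_upwards [havg] with ω hω
    filter_upwards [hω.eventually_sum_outOfBag_ne_zero hS hmn] with V hV
    exact abs_linearizationError_le ψ hV

lemma tendstoInMeasure_tauHatSq (hS : 1 ≤ S) (hmn : m < n)
    (hζ : ∀ v, HasLaw (ζ v) (seedBagLaw S n m) P) (hind : iIndepFun ζ P)
    {ψ : (Fin p → Fin n → ℝ) → ℝ} (hψ : ContinuousAt (fderiv ℝ ψ) (crossBaggedLimit F D m)) :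
    TendstoInMeasure P (fun (V : ℕ) ω ↦ tauHatSq ψ F D fun v : Fin V ↦ ζ v ω) atTop
      fun _ ↦ ∫ c, influence F D ψ c ^ 2 ∂(seedBagLaw S n m) := by
  have := isProbabilityMeasure_seedBagLaw hS hmn.le
  have havg : ∀ᵐ ω ∂P, AveragesConverge fun v ↦ ζ v ω := ae_tendsto_average_draws hζ hind
  refine tendstoInMeasure_of_tendsto_ae (fun V ↦ (aemeasurable_comp_draws hζ
    fun z : Fin V → SeedBag S n m ↦ tauHatSq ψ F D z).aestronglyMeasurable) ?_
  filter_upwards [havg] with ω hω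
  exact hω.tendsto_tauHatSq hS hmn hψ

end Draws

end CrossBagging

open CrossBagging in
theorem theorem2 {𝒳 𝒲 : Type*} {S n p : ℕ} (hS : 1 ≤ S)
    (D : Fin n → 𝒳 × 𝒲) (F : Fin p → RegressionAlgorithm 𝒳 𝒲 S)
    (ρ : ℝ) (hρ0 : 0 < ρ) (hρ1 : ρ < 1) (hm : 1 ≤ bagSize ρ n)
    (Ψ : (Fin n → 𝒳 × 𝒲) → (Fin p → Fin n → ℝ) → ℝ)
    (U : Set (Fin p → Fin n → ℝ)) (hU : IsOpen U)
    (hηU : crossBaggedLimit F D (bagSize ρ n) ∈ U)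
    (hΨ : DifferentiableOn ℝ (Ψ D) U) :
    ∃ τsq : ℝ≥0, ∀ {Ω : Type*} [MeasurableSpace Ω] (P : Measure Ω) [IsProbabilityMeasure P]
      (ζ ζ' : ℕ → Ω → SeedBag S n (bagSize ρ n)),
      (∀ v, HasLaw (ζ v) (seedBagLaw S n (bagSize ρ n)) P) →
      (∀ v, HasLaw (ζ' v) (seedBagLaw S n (bagSize ρ n)) P) →
      iIndepFun (Sum.elim ζ ζ') P →
      TendstoInDistribution
        (fun (V : ℕ) ω ↦ √(V : ℝ) *
          (Ψ D (crossBagged F D fun v : Fin V ↦ ζ v ω) -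
            Ψ D (crossBaggedLimit F D (bagSize ρ n))))
        atTop id (fun _ ↦ P) (gaussianReal 0 τsq) ∧
      TendstoInDistribution
        (fun (V : ℕ) ω ↦ √(V : ℝ) *
          (Ψ D (crossBagged F D fun v : Fin V ↦ ζ v ω) -
            Ψ D (crossBagged F D fun v : Fin V ↦ ζ' v ω)))
        atTop id (fun _ ↦ P) (gaussianReal 0 (2 * τsq)) ∧
      (ContinuousAt (fderiv ℝ (Ψ D)) (crossBaggedLimit F D (bagSize ρ n)) →
        TendstoInMeasure P
          (fun (V : ℕ) ω ↦ tauHatSq (Ψ D) F D fun v : Fin V ↦ ζ v ω)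
          atTop fun _ ↦ (τsq : ℝ)) := by
  have hmn : bagSize ρ n < n := bagSize_lt hρ1 hm
  have hψ : DifferentiableAt ℝ (Ψ D) (crossBaggedLimit F D (bagSize ρ n)) :=
    hΨ.differentiableAt (hU.mem_nhds hηU)
  have := isProbabilityMeasure_seedBagLaw hS hmn.le
  refine ⟨(∫ c, influence F D (Ψ D) c ^ 2 ∂(seedBagLaw S n (bagSize ρ n))).toNNReal,
    fun {Ω} _ P _ ζ ζ' hζ hζ' hind ↦ ?_⟩
  have hindζ : iIndepFun ζ P := hind.precomp (g := Sum.inl) Sum.inl_injective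
  have hindζ' : iIndepFun ζ' P := hind.precomp (g := Sum.inr) Sum.inr_injective
  have hinfl := integral_influence (F := F) (D := D) hS hmn (Ψ D)
  have hone : ∀ {ξ : ℕ → Ω → SeedBag S n (bagSize ρ n)},
      (∀ v, HasLaw (ξ v) (seedBagLaw S n (bagSize ρ n)) P) → iIndepFun ξ P →
      TendstoInDistribution
        (fun (V : ℕ) ω ↦ √(V : ℝ) *
          (Ψ D (crossBagged F D fun v : Fin V ↦ ξ v ω) -
            Ψ D (crossBaggedLimit F D (bagSize ρ n))))
        atTop id (fun _ ↦ P) (gaussianReal 0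
          (∫ c, influence F D (Ψ D) c ^ 2 ∂(seedBagLaw S n (bagSize ρ n))).toNNReal) := by
    intro ξ hξ hindξ
    exact tendstoInDistribution_of_tendstoInMeasure_sub _ _
      (tendstoInDistribution_sum_draws hξ hindξ hinfl)
      (tendstoInMeasure_linearizationError hS hmn hξ hindξ hψ)
      fun V ↦ aemeasurable_comp_draws hξ fun z : Fin V → SeedBag S n (bagSize ρ n) ↦
        √(V : ℝ) * (Ψ D (crossBagged F D z) - Ψ D (crossBaggedLimit F D (bagSize ρ n)))
  refine ⟨hone hζ hindζ, ?_, fun hcont ↦ ?_⟩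
  -- The centring at `Ψ(η^∞)` cancels in the difference of the two normalized statistics.
  · let T (V : ℕ) (z : Fin V → SeedBag S n (bagSize ρ n)) : ℝ :=
      √(V : ℝ) * (Ψ D (crossBagged F D z) - Ψ D (crossBaggedLimit F D (bagSize ρ n)))
    have h := tendstoInDistribution_gaussianReal_sub (hone hζ hindζ) (hone hζ' hindζ') fun V ↦
      indepFun_draws hζ hζ' hind (T V) (T V)
    rw [← two_mul] at h
    convert h using 3 with V ω
    ring
  · rw [Real.coe_toNNReal _ (integral_nonneg fun _ ↦ sq_nonneg _)]
    exact tendstoInMeasure_tauHatSq hS hmn hζ hindζ hcont
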